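/- All graphs are directed graphs without multiple edges; loops, sources and sinks are allowed, and neither countability nor connectedness is required. For a graph $E$ with vertex set $E^0$, edge set $E^1$ and source and range maps $s,r:E^1\to E^0$, call $E$ row-finite if $s^{-1}(v)$ is finite for every $v\in E^0$. For row-finite $E$, $C^*(E)$ denotes the universal $C^*$-algebra generated by a Cuntz--Krieger $E$-family, that is, by mutually orthogonal projections $P_v$ ($v\in E^0$) and partial isometries $S_e$ ($e\in E^1$) such that $S_e^*S_e=P_{r(e)}$ for all $e\in E^1$ and $P_v=\sum_{s(e)=v}S_eS_e^*$ for all $v\in s(E^1)$. Let $v$ be a vertex of $E$ that emits more than one edge, and let $e$ be an edge with source $v$. The edge explosion of $E$ at $e$ is the graph obtained by splitting $v$ into two vertices $v'$ and $v''$ as follows: every edge whose source is not $v$ keeps its source, the edge $e$ (with all its copies) gets the source $v'$, and every other edge with source $v$ (with all its copies) gets the source $v''$; an edge whose range is not $v$ keeps its range, and every edge with range $v$ (including a loop at $v$, which may be $e$ itself) is replaced by two copies, one with range $v'$ and one with range $v''$. Two graphs $E$ and $F$ are explosion equivalent if there is a finite sequence of graphs $F_0,\dots,F_n$ with $F_0\cong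 E$ and $F_n\cong F$ such that, for every $i<n$, one of $F_i$ and $F_{i+1}$ is isomorphic to an edge explosion of the other. **Theorem.** Let $E$ be a row-finite graph, possibly with sinks, and let $F$ be a graph that is explosion equivalent to $E$. Then $F$ is row-finite, and $C^*(E)$ and $C^*(F)$ are $*$-isomorphic. -/

import Mathlib

universe u v

noncomputable section

/-! ### Directed graphs

A directed graph without multiple edges is a `Digraph V`: the vertex set is `V`, and the edges are
the pairs `(v, w)` with `E.Adj v w`.  Loops, sources and sinks are allowed. -/

namespace Digraph

variable {V : Type u} {W : Type v}

/-- The set of edges of a directed graph. -/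
def Edge (E : Digraph V) : Type u := {p : V × V // E.Adj p.1 p.2}

/-- The source of an edge. -/
def Edge.source {E : Digraph V} (e : E.Edge) : V := e.1.1

/-- The range of an edge. -/
def Edge.range {E : Digraph V} (e : E.Edge) : V := e.1.2

/-- The set of edges with source `v`. -/
def edgesFrom (E : Digraph V) (v : V) : Set E.Edge := {e | e.source = v}

/-- Every vertex emits only finitely many edges. -/
def RowFinite (E : Digraph V) : Prop := ∀ v, (E.edgesFrom v).Finite

/-! ### Explosions -/

/-- The vertex set obtained from `V` by splitting the vertex `v` into `v'` (`fst`) and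
`v''` (`snd`). -/
inductive SplitVertex (v : V) : Type u
  | old (u : V) (h : u ≠ v) : SplitVertex v
  | fst : SplitVertex v
  | snd : SplitVertex v

/-- The map from the split vertex set to the original one which sends `v'` and `v''` to `v`. -/
def SplitVertex.forget {v : V} : SplitVertex v → V
  | .old u _ => u
  | .fst => v
  | .snd => v

/-- The edge explosion of `E` at the edge `e`, with source `v`.  Edges whose source is not `v`
keep their source.  The copies of `e` have source `v'`, and the copies of all other edges with
source `v` have source `v''`.  An edge whose range is not `v` keeps its range (and has one copy);
an edge with range `v` (including a loop at `v`, which may be `e` itself) has two copies,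
with range `v'` and `v''`. -/
def edgeExplosion (E : Digraph V) (e : E.Edge) : Digraph (SplitVertex e.source) where
  Adj x y :=
    match x with
    | .old u _ => E.Adj u y.forget
    | .fst => y.forget = e.range
    | .snd => E.Adj e.source y.forget ∧ y.forget ≠ e.range

/-- `F` is (isomorphic to) an edge explosion of `E`, at an edge `e` whose source emits more
than one edge. -/
def IsEdgeExplosion (E : Digraph V) (F : Digraph W) : Prop :=
  ∃ e : E.Edge, (E.edgesFrom e.source).Nontrivial ∧ Nonempty (F.Adj ≃r (E.edgeExplosion e).Adj)

/-- Explosion equivalence: there is a finite sequence of graphs from `E` to `G` (up to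
isomorphism) such that of any two consecutive ones, one is an edge explosion of the other. -/
def ExplosionEquivalent {V W : Type u} (E : Digraph V) (G : Digraph W) : Prop :=
  ∃ (n : ℕ) (X : Fin (n + 1) → Type u) (F : ∀ i, Digraph (X i)),
    Nonempty (E.Adj ≃r (F 0).Adj) ∧ Nonempty ((F (Fin.last n)).Adj ≃r G.Adj) ∧
      ∀ i : Fin n, IsEdgeExplosion (F i.castSucc) (F i.succ) ∨
        IsEdgeExplosion (F i.succ) (F i.castSucc)

/-! ### Cuntz-Krieger families -/

/-- The Cuntz-Krieger relations of the graph `E`, for elements `P v` (`v` a vertex) and `S e`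
(`e` an edge) of a `*`-algebra, as pairs (left-hand side, right-hand side): the `P v` are mutually
orthogonal projections, the `S e` are partial isometries with `S e ^* S e = P (r e)`, and
`P v` is the sum of `S e S e ^*` over the edges `e` with source `v`, if `v` emits at least one and
only finitely many edges. -/
inductive CuntzKriegerRel (E : Digraph V) {A : Type v} [NonUnitalRing A] [StarRing A]
    (P : V → A) (S : E.Edge → A) : A → A → Prop
  | star_vertex (v : V) : CuntzKriegerRel E P S (star (P v)) (P v)
  | vertex_mul_self (v : V) : CuntzKriegerRel E P S (P v * P v) (P v)
  | vertex_mul (v w : V) (h : v ≠ w) : CuntzKriegerRel E P S (P v * P w) 0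
  | partial_isometry (e : E.Edge) : CuntzKriegerRel E P S (S e * star (S e) * S e) (S e)
  | star_mul_edge (e : E.Edge) : CuntzKriegerRel E P S (star (S e) * S e) (P e.range)
  | sum_edges (v : V) (hv : (E.edgesFrom v).Nonempty) (hfin : (E.edgesFrom v).Finite) :
      CuntzKriegerRel E P S (P v) (∑ e ∈ hfin.toFinset, S e * star (S e))

end Digraph

/-! ### The free complex `*`-algebra -/

/-- The free (non-unital) complex `*`-algebra on a set `X`: complex linear combinations of
nonempty words in the letters `x = (x, false)` and `x^* = (x, true)`. -/
abbrev FreeStarAlgebra (X : Type u) : Type u := MonoidAlgebra ℂ (FreeSemigroup (X × Bool))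

namespace FreeStarAlgebra

variable {X : Type u}

/-- The generators. -/
def of (x : X) : FreeStarAlgebra X := MonoidAlgebra.single (FreeSemigroup.of (x, false)) 1

/-- The adjoint of a word: reverse it, and replace each letter `x` by `x^*` and vice versa. -/
def wordStar : FreeSemigroup (X × Bool) →ₙ* (FreeSemigroup (X × Bool))ᵐᵒᵖ :=
  FreeSemigroup.lift fun y => MulOpposite.op (FreeSemigroup.of (y.1, !y.2))

theorem wordStar_wordStar (w : FreeSemigroup (X × Bool)) :
    (wordStar (wordStar w).unop).unop = w := by
  induction w using FreeSemigroup.recOnMul with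
  | ih1 y => simp [wordStar]
  | ih2 y w h1 h2 => simp [h1, h2]

/-- The conjugate-linear extension of the adjoint of words. -/
def starAddHom : FreeStarAlgebra X →+ FreeStarAlgebra X :=
  (Finsupp.liftAddHom fun w =>
    (MonoidAlgebra.coeffAddEquiv.symm.toAddMonoidHom.comp
      (Finsupp.singleAddHom (wordStar w).unop)).comp (starAddEquiv (R := ℂ)).toAddMonoidHom).comp
    MonoidAlgebra.coeffAddEquiv.toAddMonoidHom

theorem starAddHom_single (w : FreeSemigroup (X × Bool)) (c : ℂ) :
    starAddHom (MonoidAlgebra.single w c) = MonoidAlgebra.single (wordStar w).unop (star c) := by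
  simp [starAddHom]

instance : StarRing (FreeStarAlgebra X) where
  star := starAddHom
  star_involutive a := by
    induction a using MonoidAlgebra.induction_linear with
    | zero => simp
    | add a b ha hb => simp [ha, hb]
    | single w c => simp [starAddHom_single, wordStar_wordStar]
  star_mul a b := by
    induction a using MonoidAlgebra.induction_linear with
    | zero => simp
    | add a b ha hb => simp [add_mul, mul_add, ha, hb]
    | single w c =>
      induction b using MonoidAlgebra.induction_linear with
      | zero => simp
      | add a b ha hb => simp [add_mul, mul_add, ha, hb]
      | single w' c' =>
        simp [starAddHom_single, MonoidAlgebra.single_mul_single, mul_comm]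
  star_add a b := map_add _ a b

theorem star_single (w : FreeSemigroup (X × Bool)) (c : ℂ) :
    star (MonoidAlgebra.single w c : FreeStarAlgebra X) =
      MonoidAlgebra.single (wordStar w).unop (star c) := starAddHom_single w c

instance : StarModule ℂ (FreeStarAlgebra X) where
  star_smul c a := by
    induction a using MonoidAlgebra.induction_linear with
    | zero => simp
    | add a b ha hb => simp [ha, hb]
    | single w d => simp [star_single]

end FreeStarAlgebra

/-! ### C*-seminorms and their completions -/

/-- A C*-seminorm on a complex `*`-algebra. -/
structure CStarSeminorm (A : Type u) [NonUnitalRing A] [StarRing A] [Module ℂ A] extends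
    Seminorm ℂ A where
  mul_le' : ∀ a b, toFun (a * b) ≤ toFun a * toFun b
  star_mul_self' : ∀ a, toFun (star a * a) = toFun a ^ 2

namespace CStarSeminorm

variable {A : Type u} [NonUnitalRing A] [StarRing A] [Module ℂ A]

instance : FunLike (CStarSeminorm A) A ℝ where
  coe q := q.toFun
  coe_injective p q h := by
    rcases p with ⟨p, _, _⟩
    rcases q with ⟨q, _, _⟩
    have : p = q := DFunLike.coe_injective h
    subst this
    rfl

variable (q : CStarSeminorm A)

theorem map_zero : q 0 = 0 := _root_.map_zero q.toSeminorm
theorem nonneg (a : A) : 0 ≤ q a := apply_nonneg q.toSeminorm a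
theorem add_le (a b : A) : q (a + b) ≤ q a + q b := map_add_le_add q.toSeminorm a b
theorem map_neg (a : A) : q (-a) = q a := map_neg_eq_map q.toSeminorm a
theorem sub_le (a b : A) : q a - q b ≤ q (a - b) := by
  have := q.add_le (a - b) b
  rw [sub_add_cancel] at this
  linarith
theorem map_smul (c : ℂ) (a : A) : q (c • a) = ‖c‖ * q a := map_smul_eq_mul q.toSeminorm c a
theorem mul_le (a b : A) : q (a * b) ≤ q a * q b := q.mul_le' a b
theorem star_mul_self (a : A) : q (star a * a) = q a ^ 2 := q.star_mul_self' a

theorem le_map_star (a : A) : q a ≤ q (star a) := by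
  rcases (q.nonneg a).eq_or_lt with h | h
  · rw [← h]; exact q.nonneg _
  · have h1 := q.star_mul_self a
    have h2 := q.mul_le (star a) a
    nlinarith

theorem map_star (a : A) : q (star a) = q a :=
  le_antisymm (by simpa using q.le_map_star (star a)) (q.le_map_star a)

/-- The algebra `A`, regarded as a seminormed algebra by means of `q`. -/
@[nolint unusedArguments]
def Carrier (_q : CStarSeminorm A) : Type u := A

instance : NonUnitalRing q.Carrier := inferInstanceAs (NonUnitalRing A)
instance : StarRing q.Carrier := inferInstanceAs (StarRing A)
instance : Module ℂ q.Carrier := inferInstanceAs (Module ℂ A)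
instance [StarModule ℂ A] : StarModule ℂ q.Carrier := inferInstanceAs (StarModule ℂ A)
instance [IsScalarTower ℂ A A] : IsScalarTower ℂ q.Carrier q.Carrier :=
  inferInstanceAs (IsScalarTower ℂ A A)
instance [SMulCommClass ℂ A A] : SMulCommClass ℂ q.Carrier q.Carrier :=
  inferInstanceAs (SMulCommClass ℂ A A)

instance : SeminormedAddCommGroup q.Carrier :=
  (show AddGroupSeminorm q.Carrier from q.toSeminorm.toAddGroupSeminorm).toSeminormedAddCommGroup

theorem norm_def (a : q.Carrier) : ‖a‖ = q (show A from a) := rfl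

instance : NonUnitalSeminormedRing q.Carrier where
  __ := (inferInstance : SeminormedAddCommGroup q.Carrier)
  __ := (inferInstance : NonUnitalRing q.Carrier)
  norm_mul_le := q.mul_le

instance : NormedSpace ℂ q.Carrier where
  norm_smul_le c a := (q.map_smul c a).le

theorem isometry_star : Isometry (star : q.Carrier → q.Carrier) :=
  AddMonoidHomClass.isometry_of_norm (starAddEquiv (R := q.Carrier)) q.map_star

/-- The Hausdorff completion of `A` with respect to the C*-seminorm `q`: a C*-algebra, whose
operations extend those of `A` continuously. -/
def Completion : Type u := UniformSpace.Completion q.Carrier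

namespace Completion

instance : NormedAddCommGroup q.Completion :=
  inferInstanceAs (NormedAddCommGroup (UniformSpace.Completion q.Carrier))
instance : NormedSpace ℂ q.Completion :=
  inferInstanceAs (NormedSpace ℂ (UniformSpace.Completion q.Carrier))
instance : CompleteSpace q.Completion :=
  inferInstanceAs (CompleteSpace (UniformSpace.Completion q.Carrier))

/-- The canonical map from `A` to its completion. -/
def coe (a : A) : q.Completion := ((show q.Carrier from a : q.Carrier) : UniformSpace.Completion _)

theorem norm_coe (a : A) : ‖coe q a‖ = q a := UniformSpace.Completion.norm_coe (E := q.Carrier) a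
theorem coe_add (a b : A) : coe q (a + b) = coe q a + coe q b :=
  UniformSpace.Completion.coe_add (α := q.Carrier) a b
theorem coe_smul (c : ℂ) (a : A) : coe q (c • a) = c • coe q a :=
  UniformSpace.Completion.coe_smul (X := q.Carrier) c a
theorem coe_zero : coe q 0 = 0 := rfl

theorem induction₁ {p : q.Completion → Prop} (hp : IsClosed {x | p x}) (h : ∀ a, p (coe q a))
    (x : q.Completion) : p x :=
  UniformSpace.Completion.induction_on (α := q.Carrier) x hp h

theorem induction₂ {p : q.Completion → q.Completion → Prop}
    (hp : IsClosed {x : q.Completion × q.Completion | p x.1 x.2})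
    (h : ∀ a b, p (coe q a) (coe q b)) (x y : q.Completion) : p x y :=
  UniformSpace.Completion.induction_on₂ (α := q.Carrier) (β := q.Carrier) x y hp h

theorem induction₃ {p : q.Completion → q.Completion → q.Completion → Prop}
    (hp : IsClosed {x : q.Completion × q.Completion × q.Completion | p x.1 x.2.1 x.2.2})
    (h : ∀ a b c, p (coe q a) (coe q b) (coe q c)) (x y z : q.Completion) : p x y z :=
  UniformSpace.Completion.induction_on₃ (α := q.Carrier) (β := q.Carrier) (γ := q.Carrier)
    x y z hp h

instance : Mul q.Completion where
  mul := Function.curry <|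
    ((UniformSpace.Completion.isDenseInducing_coe (α := q.Carrier)).prodMap
      (UniformSpace.Completion.isDenseInducing_coe (α := q.Carrier))).extend
        (fun p : q.Carrier × q.Carrier =>
          ((p.1 * p.2 : q.Carrier) : UniformSpace.Completion q.Carrier))

theorem coe_mul (a b : A) : coe q (a * b) = coe q a * coe q b :=
  (((UniformSpace.Completion.isDenseInducing_coe (α := q.Carrier)).prodMap
      (UniformSpace.Completion.isDenseInducing_coe (α := q.Carrier))).extend_eq
    ((UniformSpace.Completion.continuous_coe q.Carrier).comp
      (continuous_mul (M := q.Carrier))) (a, b)).symm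

instance : ContinuousMul q.Completion where
  continuous_mul := by
    let m := (AddMonoidHom.mul : q.Carrier →+ q.Carrier →+ q.Carrier).compr₂
      UniformSpace.Completion.toCompl
    have : Continuous fun p : q.Carrier × q.Carrier => m p.1 p.2 :=
      (UniformSpace.Completion.continuous_coe q.Carrier).comp continuous_mul
    have di : IsDenseInducing (UniformSpace.Completion.toCompl :
        q.Carrier → UniformSpace.Completion q.Carrier) :=
      UniformSpace.Completion.isDenseInducing_coe
    exact (di.extend_Z_bilin di this :)

instance : Star q.Completion where
  star := UniformSpace.Completion.map (star : q.Carrier → q.Carrier)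

theorem coe_star (a : A) : coe q (star a) = star (coe q a) :=
  (UniformSpace.Completion.map_coe q.isometry_star.uniformContinuous a).symm

instance : ContinuousStar q.Completion where
  continuous_star := UniformSpace.Completion.continuous_map

instance : NonUnitalNormedRing q.Completion where
  __ := (inferInstance : NormedAddCommGroup q.Completion)
  __ := (inferInstance : Mul q.Completion)
  left_distrib := induction₃ q (isClosed_eq (by fun_prop) (by fun_prop))
    fun a b c => by simp only [← coe_mul, ← coe_add, mul_add]
  right_distrib := induction₃ q (isClosed_eq (by fun_prop) (by fun_prop))
    fun a b c => by simp only [← coe_mul, ← coe_add, add_mul]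
  zero_mul := induction₁ q (isClosed_eq (by fun_prop) (by fun_prop))
    fun a => by simp only [← coe_zero, ← coe_mul, zero_mul]
  mul_zero := induction₁ q (isClosed_eq (by fun_prop) (by fun_prop))
    fun a => by simp only [← coe_zero, ← coe_mul, mul_zero]
  mul_assoc := induction₃ q (isClosed_eq (by fun_prop) (by fun_prop))
    fun a b c => by simp only [← coe_mul, mul_assoc]
  norm_mul_le := induction₂ q (isClosed_le (by fun_prop) (by fun_prop))
    fun a b => by simpa only [← coe_mul, norm_coe] using q.mul_le a b

instance : StarRing q.Completion where
  star_involutive := induction₁ q (isClosed_eq (by fun_prop) (by fun_prop))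
    fun a => by simp only [← coe_star, star_star]
  star_mul := induction₂ q (isClosed_eq (by fun_prop) (by fun_prop))
    fun a b => by simp only [← coe_star, ← coe_mul, star_mul]
  star_add := induction₂ q (isClosed_eq (by fun_prop) (by fun_prop))
    fun a b => by simp only [← coe_star, ← coe_add, star_add]

theorem continuous_const_smul' (c : ℂ) : Continuous fun x : q.Completion => c • x :=
  continuous_const_smul c

instance [IsScalarTower ℂ A A] : IsScalarTower ℂ q.Completion q.Completion where
  smul_assoc c := induction₂ q
    (isClosed_eq (((continuous_const_smul' q c).comp continuous_fst).mul continuous_snd)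
      ((continuous_const_smul' q c).comp (continuous_fst.mul continuous_snd)))
    fun a b => by simp only [smul_eq_mul, ← coe_smul, ← coe_mul, smul_mul_assoc]

instance [SMulCommClass ℂ A A] : SMulCommClass ℂ q.Completion q.Completion where
  smul_comm c := induction₂ q
    (isClosed_eq ((continuous_const_smul' q c).comp (continuous_fst.mul continuous_snd))
      (continuous_fst.mul ((continuous_const_smul' q c).comp continuous_snd)))
    fun a b => by simp only [smul_eq_mul, ← coe_smul, ← coe_mul, mul_smul_comm]

instance [StarModule ℂ A] : StarModule ℂ q.Completion where
  star_smul c := induction₁ q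
    (isClosed_eq (continuous_star.comp (continuous_const_smul' q c))
      ((continuous_const_smul' q (star c)).comp continuous_star))
    fun a => by simp only [← coe_smul, ← coe_star, star_smul]

instance : CStarRing q.Completion where
  norm_mul_self_le := induction₁ q
    (isClosed_le (continuous_norm.mul continuous_norm)
      (continuous_norm.comp (continuous_star.mul continuous_id)))
    fun a => by
      change ‖coe q a‖ * ‖coe q a‖ ≤ ‖star (coe q a) * coe q a‖
      rw [← coe_star, ← coe_mul, norm_coe, norm_coe, q.star_mul_self, sq]

instance [IsScalarTower ℂ A A] [SMulCommClass ℂ A A] [StarModule ℂ A] :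
    NonUnitalCStarAlgebra q.Completion where

end Completion

end CStarSeminorm

namespace Digraph

variable {V : Type u} (E : Digraph V)

/-! ### The graph C*-algebra -/

/-- The free `*`-algebra on the vertices and edges of `E`. -/
abbrev FreeAlg : Type u := FreeStarAlgebra (V ⊕ E.Edge)

/-- The generator of the free `*`-algebra which corresponds to a vertex. -/
def freeVertex (v : V) : E.FreeAlg := FreeStarAlgebra.of (Sum.inl v)

/-- The generator of the free `*`-algebra which corresponds to an edge. -/
def freeEdge (e : E.Edge) : E.FreeAlg := FreeStarAlgebra.of (Sum.inr e)

/-- The C*-seminorms on the free `*`-algebra modulo which the generators satisfy the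
Cuntz-Krieger relations. -/
abbrev CKSeminorm : Type u :=
  {q : CStarSeminorm E.FreeAlg //
    ∀ a b, CuntzKriegerRel E E.freeVertex E.freeEdge a b → q (a - b) = 0}

theorem CKSeminorm.eq_of_rel (q : E.CKSeminorm) {a b : E.FreeAlg}
    (h : CuntzKriegerRel E E.freeVertex E.freeEdge a b) : q.1 a = q.1 b := by
  have h1 := q.2 a b h
  have h2 := q.1.sub_le a b
  have h3 := q.1.sub_le b a
  rw [← neg_sub a b, q.1.map_neg] at h3
  linarith

theorem CKSeminorm.vertex_le_one (q : E.CKSeminorm) (v : V) : q.1 (E.freeVertex v) ≤ 1 := by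
  have h1 := CKSeminorm.eq_of_rel E q (.vertex_mul_self v)
  have h2 := q.2 _ _ (.star_vertex v)
  have h3 := q.1.star_mul_self (E.freeVertex v)
  have h4 : q.1 (star (E.freeVertex v) * E.freeVertex v) = q.1 (E.freeVertex v) := by
    refine le_antisymm ?_ ?_
    · have := q.1.add_le ((star (E.freeVertex v) - E.freeVertex v) * E.freeVertex v)
        (E.freeVertex v * E.freeVertex v)
      have h5 := q.1.mul_le (star (E.freeVertex v) - E.freeVertex v) (E.freeVertex v)
      rw [← add_mul, sub_add_cancel] at this
      rw [h2, zero_mul] at h5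
      linarith
    · have := q.1.sub_le (E.freeVertex v * E.freeVertex v)
        (star (E.freeVertex v) * E.freeVertex v)
      have h5 := q.1.mul_le (star (E.freeVertex v) - E.freeVertex v) (E.freeVertex v)
      rw [← sub_mul, ← neg_sub (star _), neg_mul, q.1.map_neg] at this
      rw [h2, zero_mul] at h5
      linarith
  nlinarith [q.1.nonneg (E.freeVertex v)]

theorem CKSeminorm.edge_le_one (q : E.CKSeminorm) (e : E.Edge) : q.1 (E.freeEdge e) ≤ 1 := by
  have h1 := CKSeminorm.eq_of_rel E q (.star_mul_edge e)
  have h2 := CKSeminorm.vertex_le_one E q e.range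
  rw [q.1.star_mul_self] at h1
  nlinarith [q.1.nonneg (E.freeEdge e)]

theorem CKSeminorm.letter_le_one (q : E.CKSeminorm) (y : (V ⊕ E.Edge) × Bool) :
    q.1 (MonoidAlgebra.single (FreeSemigroup.of y) 1) ≤ 1 := by
  have h (x : V ⊕ E.Edge) : q.1 (FreeStarAlgebra.of x) ≤ 1 := by
    rcases x with v | e
    · exact CKSeminorm.vertex_le_one E q v
    · exact CKSeminorm.edge_le_one E q e
  rcases y with ⟨x, _ | _⟩
  · exact h x
  · have h2 : (MonoidAlgebra.single (FreeSemigroup.of (x, true)) 1 : E.FreeAlg) =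
        star (FreeStarAlgebra.of x) := by
      rw [FreeStarAlgebra.of, FreeStarAlgebra.star_single]
      simp [FreeStarAlgebra.wordStar]
    rw [h2, q.1.map_star]
    exact h x

theorem CKSeminorm.bddAbove (a : E.FreeAlg) :
    BddAbove (Set.range fun q : E.CKSeminorm => q.1 a) := by
  suffices h : ∃ C, ∀ q : E.CKSeminorm, q.1 a ≤ C by
    obtain ⟨C, hC⟩ := h
    exact ⟨C, by rintro _ ⟨q, rfl⟩; exact hC q⟩
  induction a using MonoidAlgebra.induction_linear with
  | zero => exact ⟨0, fun q => q.1.map_zero.le⟩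
  | add a b ha hb =>
    obtain ⟨C, hC⟩ := ha
    obtain ⟨D, hD⟩ := hb
    exact ⟨C + D, fun q => (q.1.add_le a b).trans (add_le_add (hC q) (hD q))⟩
  | single w c =>
    refine ⟨‖c‖, fun q => ?_⟩
    have h : q.1 (MonoidAlgebra.single w 1) ≤ 1 := by
      induction w using FreeSemigroup.recOnMul with
      | ih1 y => exact CKSeminorm.letter_le_one E q y
      | ih2 y w h1 h2 =>
        have h3 := q.1.mul_le (MonoidAlgebra.single (FreeSemigroup.of y) 1)
          (MonoidAlgebra.single w 1)
        rw [MonoidAlgebra.single_mul_single, one_mul] at h3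
        exact h3.trans (mul_le_one₀ h1 (q.1.nonneg _) h2)
    have h4 : (MonoidAlgebra.single w c : E.FreeAlg) = c • MonoidAlgebra.single w 1 := by simp
    rw [h4, q.1.map_smul]
    exact mul_le_of_le_one_right (norm_nonneg c) h

instance : Nonempty E.CKSeminorm :=
  ⟨⟨{ toSeminorm := 0, mul_le' := fun _ _ => (mul_zero (0 : ℝ)).ge,
      star_mul_self' := fun _ => (zero_pow two_ne_zero).symm },
    fun _ _ _ => rfl⟩⟩

theorem CKSeminorm.le_iSup (q : E.CKSeminorm) (a : E.FreeAlg) :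
    q.1 a ≤ ⨆ q : E.CKSeminorm, q.1 a := le_ciSup (CKSeminorm.bddAbove E a) q

theorem CKSeminorm.iSup_nonneg (a : E.FreeAlg) : 0 ≤ ⨆ q : E.CKSeminorm, q.1 a :=
  Real.iSup_nonneg fun q => q.1.nonneg a

/-- The universal C*-seminorm: the largest one modulo which the generators satisfy the
Cuntz-Krieger relations. -/
def universalSeminorm : CStarSeminorm E.FreeAlg where
  toSeminorm := Seminorm.of (fun a => ⨆ q : E.CKSeminorm, q.1 a)
    (fun a b => ciSup_le fun q => (q.1.add_le a b).trans
      (add_le_add (CKSeminorm.le_iSup E q a) (CKSeminorm.le_iSup E q b)))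
    (fun c a => by
      simp only [CStarSeminorm.map_smul]
      exact (Real.mul_iSup_of_nonneg (norm_nonneg c) _).symm)
  mul_le' a b := ciSup_le fun q => (q.1.mul_le a b).trans
    (mul_le_mul (CKSeminorm.le_iSup E q a) (CKSeminorm.le_iSup E q b) (q.1.nonneg b)
      (CKSeminorm.iSup_nonneg E a))
  star_mul_self' a := by
    change (⨆ q : E.CKSeminorm, q.1 (star a * a)) = (⨆ q : E.CKSeminorm, q.1 a) ^ 2
    simp only [CStarSeminorm.star_mul_self]
    refine le_antisymm (ciSup_le fun q => ?_) ?_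
    · exact pow_le_pow_left₀ (q.1.nonneg a) (CKSeminorm.le_iSup E q a) 2
    · have h0 : 0 ≤ ⨆ q : E.CKSeminorm, q.1 a ^ 2 := Real.iSup_nonneg fun q => sq_nonneg _
      rw [← Real.le_sqrt (CKSeminorm.iSup_nonneg E a) h0]
      refine ciSup_le fun q => Real.le_sqrt_of_sq_le ?_
      have hb : BddAbove (Set.range fun q : E.CKSeminorm => q.1 a ^ 2) := by
        simpa only [CStarSeminorm.star_mul_self] using CKSeminorm.bddAbove E (star a * a)
      exact le_ciSup hb q

/-- The graph C*-algebra `C^*(E)`: the universal C*-algebra generated by a Cuntz-Krieger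
`E`-family, obtained from the free `*`-algebra on the vertices and edges by completing it with
respect to the universal C*-seminorm. -/
abbrev GraphCStarAlgebra : Type u := E.universalSeminorm.Completion

/-- The canonical projections of `C^*(E)`. -/
def canonicalVertex (v : V) : E.GraphCStarAlgebra :=
  CStarSeminorm.Completion.coe _ (E.freeVertex v)

/-- The canonical partial isometries of `C^*(E)`. -/
def canonicalEdge (e : E.Edge) : E.GraphCStarAlgebra :=
  CStarSeminorm.Completion.coe _ (E.freeEdge e)

end Digraph

end

-- An edge explosion is an out-splitting: there is a map φ from the new vertices to the old ones,
-- and a map σ giving each edge (v, w) the common source of its copies, one copy for each vertex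
-- above w. Graph isomorphisms are the case of one-point fibres, so a single theorem about
-- `IsOutSplit` covers every link of the chain.
--
-- For row-finite E, Cuntz-Krieger families of E and F determine each other. From (p, s) for F, put
-- P_v = Σ p_x over the x above v and T_{v,w} = Σ s_{σ(v,w),y} over the y above w (`collapse`). From
-- (P, S) for E, let Q_x be the sum of S_{v,w} S_{v,w}^* over the edges with σ(v,w) = x, or P_v if v
-- = φ(x) is a sink, and put t_{x,y} = S_{φ(x),φ(y)} Q_y (`split`). The universal property turns
-- these families into homomorphisms in both directions, and they are inverse on generators.
--
-- Two points need care. Orthogonality of the range projections at a vertex is not a relation; it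
-- follows because projections summing to a projection are orthogonal. And a vertex sharing its
-- fibre with another must emit an edge (`exists_adj`): sinks are not split and no sinks are
-- created, so the summation relation is available exactly where it is needed.

universe w

noncomputable section

/-! ### Universal properties of the free *-algebra, of completions, and of C^*(E). -/

namespace FreeStarAlgebra

variable {X : Type u} {A : Type w} [NonUnitalRing A] [StarRing A]

/-- The value of a word at an assignment of its letters. -/
def wordLift (f : X → A) : FreeSemigroup (X × Bool) →ₙ* A :=
  FreeSemigroup.lift fun y => if y.2 then star (f y.1) else f y.1

theorem wordLift_wordStar (f : X → A) (w : FreeSemigroup (X × Bool)) :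
    wordLift f (wordStar w).unop = star (wordLift f w) := by
  induction w using FreeSemigroup.recOnMul with
  | ih1 y =>
    rcases y with ⟨x, _ | _⟩ <;> simp [wordStar, wordLift]
  | ih2 y w h1 h2 => simp [h1, h2]

variable [Module ℂ A] [StarModule ℂ A] [IsScalarTower ℂ A A] [SMulCommClass ℂ A A]

/-- The `*`-homomorphism from the free `*`-algebra with prescribed values at the generators. -/
def lift (f : X → A) : FreeStarAlgebra X →⋆ₙₐ[ℂ] A where
  toNonUnitalAlgHom := MonoidAlgebra.liftMagma ℂ (wordLift f)
  map_star' a := by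
    change MonoidAlgebra.liftMagma ℂ (wordLift f) (star a) =
      star (MonoidAlgebra.liftMagma ℂ (wordLift f) a)
    induction a using MonoidAlgebra.induction_linear with
    | zero => simp
    | add a b ha hb => rw [star_add, map_add, map_add, star_add, ha, hb]
    | single w c => simp [star_single, wordLift_wordStar]

theorem lift_of (f : X → A) (x : X) : lift f (of x) = f x := by
  change MonoidAlgebra.liftMagma ℂ (wordLift f) (of x) = f x
  simp [of, wordLift]

/-- Elements are linear combinations of words, and each word is a product of generators and their
adjoints. -/
theorem of_induction {p : FreeStarAlgebra X → Prop} (zero : p 0)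
    (add : ∀ a b, p a → p b → p (a + b)) (mul : ∀ a b, p a → p b → p (a * b))
    (smul : ∀ (c : ℂ) a, p a → p (c • a)) (star' : ∀ a, p a → p (star a))
    (of' : ∀ x, p (of x)) (a : FreeStarAlgebra X) : p a := by
  induction a using MonoidAlgebra.induction_linear with
  | zero => exact zero
  | add a b ha hb => exact add a b ha hb
  | single w c =>
    have h4 : (MonoidAlgebra.single w c : FreeStarAlgebra X) = c • MonoidAlgebra.single w 1 := by
      simp
    rw [h4]
    apply smul
    have hy (y : X × Bool) : p (MonoidAlgebra.single (FreeSemigroup.of y) 1) := by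
      rcases y with ⟨x, _ | _⟩
      · exact of' x
      · have := star' _ (of' x)
        rw [of, star_single] at this
        simpa [wordStar] using this
    induction w using FreeSemigroup.recOnMul with
    | ih1 y => exact hy y
    | ih2 y w h1 h2 =>
      have := mul _ _ (hy y) (h2 (by simp))
      rwa [MonoidAlgebra.single_mul_single, one_mul] at this

end FreeStarAlgebra

namespace CStarSeminorm

variable {A : Type u} [NonUnitalRing A] [StarRing A] [Module ℂ A]
  {B : Type w} [NonUnitalCStarAlgebra B]

/-- The C*-seminorm induced by a `*`-homomorphism to a C*-algebra. -/
def ofHom (f : A →⋆ₙₐ[ℂ] B) : CStarSeminorm A where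
  toSeminorm := Seminorm.of (fun a => ‖f a‖)
    (fun a b => by rw [map_add]; exact norm_add_le _ _)
    (fun c a => by rw [_root_.map_smul, norm_smul])
  mul_le' a b := by
    change ‖f (a * b)‖ ≤ ‖f a‖ * ‖f b‖
    rw [map_mul]
    exact norm_mul_le _ _
  star_mul_self' a := by
    change ‖f (star a * a)‖ = ‖f a‖ ^ 2
    rw [map_mul, StarHomClass.map_star, CStarRing.norm_star_mul_self, sq]

theorem ofHom_apply (f : A →⋆ₙₐ[ℂ] B) (a : A) : ofHom f a = ‖f a‖ := rfl

variable (q : CStarSeminorm A)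

theorem Completion.lift_uniformContinuous (f : A →⋆ₙₐ[ℂ] B) (hf : ∀ a, ‖f a‖ ≤ q a) :
    UniformContinuous (fun a : q.Carrier => f (show A from a)) := by
  refine (LipschitzWith.of_dist_le_mul (K := 1) fun a b => ?_).uniformContinuous
  rw [dist_eq_norm, dist_eq_norm, NNReal.coe_one, one_mul]
  have := hf ((show A from a) - (show A from b))
  rwa [map_sub] at this

/-- The extension of a contractive `*`-homomorphism to the completion. -/
def Completion.lift (f : A →⋆ₙₐ[ℂ] B) (hf : ∀ a, ‖f a‖ ≤ q a) : q.Completion →⋆ₙₐ[ℂ] B :=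
  let g : q.Completion → B :=
    UniformSpace.Completion.extension (fun a : q.Carrier => f (show A from a))
  have hg : Continuous g := UniformSpace.Completion.continuous_extension
  have hc (a : A) : g (coe q a) = f a :=
    UniformSpace.Completion.extension_coe (Completion.lift_uniformContinuous q f hf) a
  { toFun := g
    map_smul' := fun c => induction₁ q
      (isClosed_eq (hg.comp (continuous_const_smul' q c)) (hg.const_smul c))
      fun a => by simp only [← coe_smul, hc, _root_.map_smul, MonoidHom.id_apply]
    map_zero' := by rw [← coe_zero, hc, _root_.map_zero]
    map_add' := induction₂ q (isClosed_eq (by fun_prop) (by fun_prop))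
      fun a b => by simp only [← coe_add, hc, map_add]
    map_mul' := induction₂ q (isClosed_eq (by fun_prop) (by fun_prop))
      fun a b => by simp only [← coe_mul, hc, map_mul]
    map_star' := induction₁ q (isClosed_eq (by fun_prop) (by fun_prop))
      fun a => by simp only [← coe_star, hc, StarHomClass.map_star] }

theorem Completion.lift_coe (f : A →⋆ₙₐ[ℂ] B) (hf : ∀ a, ‖f a‖ ≤ q a) (a : A) :
    Completion.lift q f hf (coe q a) = f a :=
  UniformSpace.Completion.extension_coe (Completion.lift_uniformContinuous q f hf) a

/-- The canonical map to the completion, as a `*`-homomorphism. -/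
def Completion.coeHom : A →⋆ₙₐ[ℂ] q.Completion where
  toFun := coe q
  map_smul' := coe_smul q
  map_zero' := coe_zero q
  map_add' := coe_add q
  map_mul' := coe_mul q
  map_star' := coe_star q

end CStarSeminorm

namespace Digraph

variable {V : Type u} {E : Digraph V} {A : Type w} [NonUnitalCStarAlgebra A]

theorem CuntzKriegerRel.map {B : Type v} {C : Type w} [NonUnitalRing B] [StarRing B] [Module ℂ B]
    [NonUnitalRing C] [StarRing C] [Module ℂ C] (f : B →⋆ₙₐ[ℂ] C)
    {P : V → B} {S : E.Edge → B} {a b : B} (h : CuntzKriegerRel E P S a b) :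
    CuntzKriegerRel E (fun v => f (P v)) (fun e => f (S e)) (f a) (f b) := by
  cases h with
  | star_vertex v => rw [map_star]; exact .star_vertex v
  | vertex_mul_self v => rw [map_mul]; exact .vertex_mul_self v
  | vertex_mul v w h => rw [map_mul, map_zero]; exact .vertex_mul v w h
  | partial_isometry e => rw [map_mul, map_mul, map_star]; exact .partial_isometry e
  | star_mul_edge e => rw [map_mul, map_star]; exact .star_mul_edge e
  | sum_edges v hv hfin =>
    rw [map_sum]
    simp only [map_mul, map_star]
    exact .sum_edges v hv hfin

/-- The universal property of the graph C*-algebra: existence. -/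
theorem GraphCStarAlgebra.exists_hom (P : V → A) (S : E.Edge → A)
    (h : ∀ a b, CuntzKriegerRel E P S a b → a = b) :
    ∃ f : E.GraphCStarAlgebra →⋆ₙₐ[ℂ] A,
      (∀ v, f (E.canonicalVertex v) = P v) ∧ ∀ e, f (E.canonicalEdge e) = S e := by
  let g : E.FreeAlg →⋆ₙₐ[ℂ] A := FreeStarAlgebra.lift (Sum.elim P S)
  have hP (v : V) : g (E.freeVertex v) = P v := FreeStarAlgebra.lift_of _ _
  have hS (e : E.Edge) : g (E.freeEdge e) = S e := FreeStarAlgebra.lift_of _ _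
  -- The pulled-back norm is one of the seminorms in the supremum, so `g` is contractive for the
  -- universal seminorm and extends to the completion.
  let q : E.CKSeminorm := ⟨CStarSeminorm.ofHom g, fun a b hab => by
    have := hab.map g
    simp only [hP, hS] at this
    rw [CStarSeminorm.ofHom_apply, map_sub, h _ _ this, sub_self, norm_zero]⟩
  have hg (a : E.FreeAlg) : ‖g a‖ ≤ E.universalSeminorm a := CKSeminorm.le_iSup E q a
  refine ⟨CStarSeminorm.Completion.lift _ g hg, fun v => ?_, fun e => ?_⟩
  · rw [canonicalVertex, CStarSeminorm.Completion.lift_coe, hP]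
  · rw [canonicalEdge, CStarSeminorm.Completion.lift_coe, hS]

open scoped CStarAlgebra in
/-- The universal property of the graph C*-algebra: uniqueness. -/
theorem GraphCStarAlgebra.hom_ext {f g : E.GraphCStarAlgebra →⋆ₙₐ[ℂ] A}
    (hP : ∀ v, f (E.canonicalVertex v) = g (E.canonicalVertex v))
    (hS : ∀ e, f (E.canonicalEdge e) = g (E.canonicalEdge e)) : f = g := by
  ext x
  revert x
  -- Star homomorphisms of C*-algebras are automatically continuous, so agreement on the dense image
  -- of the free algebra suffices.
  refine CStarSeminorm.Completion.induction₁ _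
    (isClosed_eq (map_continuous f) (map_continuous g)) fun a => ?_
  induction a using FreeStarAlgebra.of_induction with
  | zero => simp only [CStarSeminorm.Completion.coe_zero, map_zero]
  | add a b ha hb => simp only [CStarSeminorm.Completion.coe_add, map_add, ha, hb]
  | mul a b ha hb => simp only [CStarSeminorm.Completion.coe_mul, map_mul, ha, hb]
  | smul c a ha => simp only [CStarSeminorm.Completion.coe_smul, map_smul, ha]
  | star' a ha => simp only [CStarSeminorm.Completion.coe_star, map_star, ha]
  | of' x =>
    rcases x with v | e
    · exact hP v
    · exact hS e

variable (E) in
/-- The canonical generators of the graph C*-algebra satisfy the Cuntz-Krieger relations. -/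
theorem GraphCStarAlgebra.eq_of_rel {a b : E.GraphCStarAlgebra}
    (h : CuntzKriegerRel E E.canonicalVertex E.canonicalEdge a b) : a = b := by
  have key {a b : E.FreeAlg} (h : CuntzKriegerRel E E.freeVertex E.freeEdge a b) :
      CStarSeminorm.Completion.coeHom E.universalSeminorm a =
        CStarSeminorm.Completion.coeHom E.universalSeminorm b := by
    rw [← sub_eq_zero, ← map_sub, ← norm_eq_zero]
    refine (CStarSeminorm.Completion.norm_coe _ _).trans ?_
    refine le_antisymm (ciSup_le fun q => (q.2 a b h).le) (CKSeminorm.iSup_nonneg E _)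
  have hP (v : V) : CStarSeminorm.Completion.coeHom E.universalSeminorm (E.freeVertex v) =
      E.canonicalVertex v := rfl
  have hS (e : E.Edge) : CStarSeminorm.Completion.coeHom E.universalSeminorm (E.freeEdge e) =
      E.canonicalEdge e := rfl
  cases h with
  | star_vertex v => simpa only [map_star, hP] using key (.star_vertex v)
  | vertex_mul_self v => simpa only [map_mul, hP] using key (.vertex_mul_self v)
  | vertex_mul v w h => simpa only [map_mul, hP, map_zero] using key (.vertex_mul v w h)
  | partial_isometry e => simpa only [map_mul, map_star, hS] using key (.partial_isometry e)
  | star_mul_edge e => simpa only [map_mul, map_star, hS, hP] using key (.star_mul_edge e)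
  | sum_edges v hv hfin =>
    simpa only [map_sum, map_mul, map_star, hS, hP] using key (.sum_edges v hv hfin)

end Digraph

end

/-! ### Projections and partial isometries in C*-algebras. -/

noncomputable section

/-- Projections in a C*-algebra whose sum is a projection are mutually orthogonal. -/
theorem mul_eq_zero_of_sum_projection {A ι : Type*} [NonUnitalCStarAlgebra A] {s : Finset ι}
    {p : ι → A} (hs : ∀ i ∈ s, star (p i) = p i) (hm : ∀ i ∈ s, p i * p i = p i)
    (hss : star (∑ i ∈ s, p i) = ∑ i ∈ s, p i)
    (hsm : (∑ i ∈ s, p i) * (∑ i ∈ s, p i) = ∑ i ∈ s, p i)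
    {i j : ι} (hi : i ∈ s) (hj : j ∈ s) (hij : i ≠ j) : p i * p j = 0 := by
  classical
  let _ := CStarAlgebra.spectralOrder A
  have := CStarAlgebra.spectralOrderedRing A
  set P := ∑ i ∈ s, p i with hP
  have hnorm : ‖P‖ ≤ 1 := by
    have h := CStarRing.norm_star_mul_self (x := P)
    rw [hss, hsm] at h
    nlinarith [norm_nonneg P]
  have h0 : 0 ≤ p i := by
    have := star_mul_self_nonneg (p i)
    rwa [hs i hi, hm i hi] at this
  -- Compressing the sum P by p_i gives p_i P p_i ≤ ‖P‖ p_i ≤ p_i. The term k = i already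
  -- contributes p_i, so the other, positive, terms p_i p_k p_i must all vanish.
  have h1 : p i * P * p i ≤ p i := by
    have h := CStarAlgebra.star_left_conjugate_le_norm_smul (a := p i) (b := P) hss
    rw [hs i hi, hm i hi] at h
    refine h.trans ?_
    calc ‖P‖ • p i ≤ (1 : ℝ) • p i := smul_le_smul_of_nonneg_right hnorm h0
      _ = p i := one_smul _ _
  have hpos (k : ι) (hk : k ∈ s) : 0 ≤ p i * p k * p i := by
    have := star_mul_self_nonneg (p k * p i)
    rwa [star_mul, hs i hi, hs k hk, mul_assoc, ← mul_assoc (p k), hm k hk, ← mul_assoc] at this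
  have h2 : p i * P * p i = p i + ∑ k ∈ s.erase i, p i * p k * p i := by
    rw [hP, Finset.mul_sum, Finset.sum_mul, ← Finset.add_sum_erase s _ hi, hm i hi, hm i hi]
  have h3 : ∑ k ∈ s.erase i, p i * p k * p i = 0 := by
    refine le_antisymm ?_ (Finset.sum_nonneg fun k hk => hpos k (Finset.mem_of_mem_erase hk))
    rw [h2] at h1
    simpa using h1
  have h4 := (Finset.sum_eq_zero_iff_of_nonneg
    fun k hk => hpos k (Finset.mem_of_mem_erase hk)).1 h3 j (Finset.mem_erase.2 ⟨hij.symm, hj⟩)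
  -- By the C*-identity, since (p_j p_i)^*(p_j p_i) = p_i p_j p_i.
  have h5 : p j * p i = 0 := by
    rw [← CStarRing.star_mul_self_eq_zero_iff, star_mul, hs i hi, hs j hj, mul_assoc,
      ← mul_assoc (p j), hm j hj, ← mul_assoc, h4]
  have := congrArg star h5
  rwa [star_mul, hs i hi, hs j hj, star_zero] at this

/-- By the C*-identity it is enough that (sp - s)^*(sp - s) = ppp - pp - pp + p = 0. -/
theorem mul_eq_self_of_star_mul_self {A : Type*} [NonUnitalCStarAlgebra A] {s p : A}
    (hs : star p = p) (hm : p * p = p) (h : star s * s = p) : s * p = s := by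
  rw [← sub_eq_zero, ← CStarRing.star_mul_self_eq_zero_iff, star_sub, star_mul, hs]
  simp only [sub_mul, mul_sub, ← mul_assoc]
  rw [mul_assoc p, h]
  simp [hm]

/-! ### Cuntz-Krieger families indexed by pairs of vertices. -/

namespace Digraph

variable {V : Type u} {E : Digraph V} {A : Type w} [NonUnitalCStarAlgebra A]

/-- A Cuntz-Krieger family of the graph `E`, with partial isometries indexed by the pairs of
vertices, which vanish at the pairs that are not edges. -/
structure IsCKFamily (E : Digraph V) (P : V → A) (S : V → V → A) : Prop where
  star_vertex : ∀ v, star (P v) = P v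
  vertex_mul_self : ∀ v, P v * P v = P v
  vertex_mul : ∀ v w, v ≠ w → P v * P w = 0
  star_mul_edge : ∀ v w, E.Adj v w → star (S v w) * S v w = P w
  eq_zero : ∀ v w, ¬ E.Adj v w → S v w = 0
  sum_edges : ∀ v (N : Finset V), (∀ w, w ∈ N ↔ E.Adj v w) → N.Nonempty →
    P v = ∑ w ∈ N, S v w * star (S v w)

namespace IsCKFamily

variable {P : V → A} {S : V → V → A} (h : IsCKFamily E P S)
include h

theorem edge_mul_vertex (v w : V) : S v w * P w = S v w := by
  by_cases hvw : E.Adj v w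
  · exact mul_eq_self_of_star_mul_self (h.star_vertex w) (h.vertex_mul_self w)
      (h.star_mul_edge v w hvw)
  · rw [h.eq_zero v w hvw, zero_mul]

theorem vertex_mul_star_edge (v w : V) : P w * star (S v w) = star (S v w) := by
  simpa [h.star_vertex] using congrArg star (h.edge_mul_vertex v w)

/-- The partial isometry relation is a consequence of S^*S = P and SP = S, which is why `IsCKFamily`
omits it. -/
theorem edge_mul_star_mul_edge (v w : V) : S v w * star (S v w) * S v w = S v w := by
  by_cases hvw : E.Adj v w
  · rw [mul_assoc, h.star_mul_edge v w hvw, h.edge_mul_vertex]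
  · simp [h.eq_zero v w hvw]

theorem star_mul_edge_mul_star (v w : V) :
    star (S v w) * (S v w * star (S v w)) = star (S v w) := by
  simpa using congrArg star (h.edge_mul_star_mul_edge v w)

theorem edge_mul_star_of_ne (u v : V) {w x : V} (hwx : w ≠ x) : S u w * star (S v x) = 0 := by
  rw [← h.edge_mul_vertex u w, ← h.vertex_mul_star_edge v x, mul_assoc, ← mul_assoc (P w),
    h.vertex_mul w x hwx, zero_mul, mul_zero]

/-- The range projections at v add up to the projection P_v, hence are mutually orthogonal;
inserting them gives S_w^* S_x = S_w^* (S_w S_w^*)(S_x S_x^*) S_x = 0. Finite emission at v is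
essential here, as it makes the summation relation available. -/
theorem star_mul_edge_of_ne {v w x : V} (N : Finset V) (hN : ∀ w, w ∈ N ↔ E.Adj v w)
    (hwx : w ≠ x) : star (S v w) * S v x = 0 := by
  by_cases hw : E.Adj v w
  swap
  · rw [h.eq_zero v w hw, star_zero, zero_mul]
  by_cases hx : E.Adj v x
  swap
  · rw [h.eq_zero v x hx, mul_zero]
  have hs := h.sum_edges v N hN ⟨w, (hN w).2 hw⟩
  have key : S v w * star (S v w) * (S v x * star (S v x)) = 0 :=
    mul_eq_zero_of_sum_projection (s := N) (p := fun w => S v w * star (S v w))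
      (fun i _ => by simp)
      (fun i _ => by simp only [← mul_assoc, h.edge_mul_star_mul_edge])
      (by rw [← hs, h.star_vertex]) (by rw [← hs, h.vertex_mul_self])
      ((hN w).2 hw) ((hN x).2 hx) hwx
  rw [← h.star_mul_edge_mul_star, ← h.edge_mul_star_mul_edge v x, mul_assoc, ← mul_assoc (_ * _),
    key, zero_mul, mul_zero]

theorem vertex_mul_edge {v : V} (N : Finset V) (hN : ∀ w, w ∈ N ↔ E.Adj v w) (w : V) :
    P v * S v w = S v w := by
  by_cases hw : E.Adj v w
  · rw [h.sum_edges v N hN ⟨w, (hN w).2 hw⟩, Finset.sum_mul,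
      Finset.sum_eq_single_of_mem w ((hN w).2 hw), h.edge_mul_star_mul_edge]
    intro x _ hx
    rw [mul_assoc, h.star_mul_edge_of_ne N hN hx, mul_zero]
  · rw [h.eq_zero v w hw, mul_zero]

theorem eq_of_rel {a b : A} (hab : CuntzKriegerRel E P (fun e => S e.source e.range) a b) :
    a = b := by
  classical
  cases hab with
  | star_vertex v => exact h.star_vertex v
  | vertex_mul_self v => exact h.vertex_mul_self v
  | vertex_mul v w hvw => exact h.vertex_mul v w hvw
  | partial_isometry e => exact h.edge_mul_star_mul_edge _ _
  | star_mul_edge e => exact h.star_mul_edge _ _ e.2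
  | sum_edges v hv hfin =>
    -- Without multiple edges, an edge leaving v is determined by its range.
    rw [h.sum_edges v (hfin.toFinset.image Edge.range), Finset.sum_image]
    · refine Finset.sum_congr rfl fun e he => ?_
      have he : e.source = v := by simpa [edgesFrom] using he
      rw [he]
    · intro e he f hf hef
      have he : e.source = v := by simpa [edgesFrom] using he
      have hf : f.source = v := by simpa [edgesFrom] using hf
      exact Subtype.ext (Prod.ext (he.trans hf.symm) hef)
    · intro w
      simp only [Finset.mem_image, Set.Finite.mem_toFinset]
      constructor
      · rintro ⟨e, rfl, rfl⟩
        exact e.2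
      · intro hw
        exact ⟨⟨(v, w), hw⟩, rfl, rfl⟩
    · simpa using hv

theorem exists_hom : ∃ f : E.GraphCStarAlgebra →⋆ₙₐ[ℂ] A,
    (∀ v, f (E.canonicalVertex v) = P v) ∧
      ∀ e, f (E.canonicalEdge e) = S e.source e.range :=
  GraphCStarAlgebra.exists_hom P (fun e => S e.source e.range) fun _ _ => h.eq_of_rel

end IsCKFamily

open Classical in
/-- The canonical partial isometries of `C^*(E)`, extended by zero to all pairs of vertices. -/
def canonicalPair (E : Digraph V) (v w : V) : E.GraphCStarAlgebra :=
  if h : E.Adj v w then E.canonicalEdge ⟨(v, w), h⟩ else 0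

theorem canonicalPair_source_range (e : E.Edge) :
    E.canonicalPair e.source e.range = E.canonicalEdge e := dif_pos e.2

theorem isCKFamily_canonical (E : Digraph V) :
    IsCKFamily E E.canonicalVertex E.canonicalPair where
  star_vertex v := GraphCStarAlgebra.eq_of_rel E (.star_vertex v)
  vertex_mul_self v := GraphCStarAlgebra.eq_of_rel E (.vertex_mul_self v)
  vertex_mul v w h := GraphCStarAlgebra.eq_of_rel E (.vertex_mul v w h)
  star_mul_edge v w h := by
    rw [canonicalPair, dif_pos h]
    exact GraphCStarAlgebra.eq_of_rel E (.star_mul_edge ⟨(v, w), h⟩)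
  eq_zero v w h := dif_neg h
  sum_edges v N hN hne := by
    classical
    have hfin : (E.edgesFrom v).Finite := by
      refine Set.Finite.of_finite_image (f := Edge.range) (N.finite_toSet.subset ?_) ?_
      · rintro _ ⟨e, rfl, rfl⟩
        exact (hN _).2 e.2
      · intro e he f hf hef
        exact Subtype.ext (Prod.ext (Eq.trans he (Eq.symm hf)) hef)
    have hv : (E.edgesFrom v).Nonempty := by
      obtain ⟨w, hw⟩ := hne
      exact ⟨⟨(v, w), (hN w).1 hw⟩, rfl⟩
    rw [GraphCStarAlgebra.eq_of_rel E (.sum_edges v hv hfin)]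
    refine Finset.sum_bij (fun e _ => e.range) ?_ ?_ ?_ ?_
    · intro e he
      have he : e.source = v := by simpa [edgesFrom] using he
      exact (hN _).2 (he ▸ e.2)
    · intro e he f hf hef
      have he : e.source = v := by simpa [edgesFrom] using he
      have hf : f.source = v := by simpa [edgesFrom] using hf
      exact Subtype.ext (Prod.ext (he.trans hf.symm) hef)
    · intro w hw
      exact ⟨⟨(v, w), (hN w).1 hw⟩, (Set.Finite.mem_toFinset _).2 rfl, rfl⟩
    · intro e he
      have he : e.source = v := by simpa [edgesFrom] using he
      rw [← he, canonicalPair_source_range]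

end Digraph

end

/-! ### Out-splittings and their combinatorics. -/

noncomputable section

namespace Digraph

variable {V W : Type u} {E : Digraph V} {F : Digraph W}

/-- `F` is obtained from `E` by splitting vertices, along a map `φ` which sends every vertex of `F`
to the vertex of `E` from which it arises, and a map `σ` which sends an edge `(v, w)` of `E` to the
common source in `F` of its copies; the copies of an edge `(v, w)` correspond to the vertices
above `w`. -/
structure IsOutSplit (E : Digraph V) (F : Digraph W) (φ : W → V) (σ : V → V → W) : Prop where
  surjective : Function.Surjective φ
  finite_fiber : ∀ v, {x | φ x = v}.Finite
  source : ∀ v w, E.Adj v w → φ (σ v w) = v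
  adj_iff : ∀ x y, F.Adj x y ↔ E.Adj (φ x) (φ y) ∧ σ (φ x) (φ y) = x
  exists_adj : ∀ x y, φ x = φ y → x ≠ y → ∃ z, F.Adj x z

theorem rowFinite_iff : E.RowFinite ↔ ∀ v, {w | E.Adj v w}.Finite := by
  refine forall_congr' fun v => ?_
  have him : Edge.range '' E.edgesFrom v = {w | E.Adj v w} := by
    ext w
    constructor
    · rintro ⟨e, rfl, rfl⟩
      exact e.2
    · intro hw
      exact ⟨⟨(v, w), hw⟩, rfl, rfl⟩
  rw [← him, Set.finite_image_iff]
  intro e he f hf hef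
  exact Subtype.ext (Prod.ext (Eq.trans he (Eq.symm hf)) hef)

theorem Edge.adj (e : E.Edge) : E.Adj e.source e.range := e.2

namespace IsOutSplit

variable {φ : W → V} {σ : V → V → W} (h : IsOutSplit E F φ σ)
include h

theorem adj_source {v w : V} {y : W} (hy : φ y = w) (hvw : E.Adj v w) : F.Adj (σ v w) y := by
  subst hy
  rw [h.adj_iff, h.source _ _ hvw]
  exact ⟨hvw, rfl⟩

/-- Fibres are finite: the neighbours of v are images of neighbours of the finitely many vertices
above v, and the neighbours of x lie above those of φ(x). -/
theorem rowFinite_iff : F.RowFinite ↔ E.RowFinite := by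
  rw [Digraph.rowFinite_iff, Digraph.rowFinite_iff]
  constructor
  · intro hF v
    refine (((h.finite_fiber v).biUnion fun x _ => hF x).image φ).subset ?_
    intro w hw
    obtain ⟨y, rfl⟩ := h.surjective w
    exact ⟨y, Set.mem_biUnion (h.source _ _ hw) (h.adj_source rfl hw), rfl⟩
  · intro hE x
    refine ((hE (φ x)).biUnion fun w _ => h.finite_fiber w).subset ?_
    intro y hy
    exact Set.mem_biUnion ((h.adj_iff _ _).1 hy).1 rfl

/-- Splitting creates no sinks: either x itself emits the copies of the given edge, or x shares its
fibre with the vertex that does. -/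
theorem exists_adj_of_adj {x : W} {w : V} (hw : E.Adj (φ x) w) : ∃ y, F.Adj x y := by
  obtain ⟨y, hy⟩ := h.surjective w
  by_cases hx : x = σ (φ x) w
  · exact ⟨y, hx ▸ h.adj_source hy hw⟩
  · exact h.exists_adj x _ (h.source _ _ hw).symm hx

/-- The edges leaving x are grouped by the edge of E they copy; each group runs over a whole fibre
of φ. -/
theorem sum_adj {A : Type*} [AddCommMonoid A] [DecidableEq W] [DecidableEq V]
    {N : V → Finset V} (hN : ∀ v w, w ∈ N v ↔ E.Adj v w)
    {fib : V → Finset W} (hfib : ∀ v x, x ∈ fib v ↔ φ x = v) {x : W} {M : Finset W}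
    (hM : ∀ y, y ∈ M ↔ F.Adj x y) (g : W → A) :
    ∑ y ∈ M, g y = ∑ w ∈ (N (φ x)).filter (fun w => σ (φ x) w = x), ∑ y ∈ fib w, g y := by
  rw [← Finset.sum_fiberwise_of_maps_to (s := M) (g := φ)
    (t := (N (φ x)).filter (fun w => σ (φ x) w = x))]
  · refine Finset.sum_congr rfl fun w hw => Finset.sum_congr ?_ fun _ _ => rfl
    ext y
    rw [Finset.mem_filter, hN] at hw
    rw [Finset.mem_filter, hM, hfib, h.adj_iff]
    constructor
    · exact fun hy => hy.2
    · rintro rfl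
      exact ⟨hw, rfl⟩
  · intro y hy
    rw [hM, h.adj_iff] at hy
    rwa [Finset.mem_filter, hN]

end IsOutSplit

/-! ### Transport of Cuntz-Krieger families along an out-splitting. -/

namespace IsCKFamily

variable {A : Type w} [NonUnitalCStarAlgebra A] {φ : W → V} {σ : V → V → W}

theorem collapse_edge_mul_star {p : W → A} {s : W → W → A} (hF : IsCKFamily F p s)
    {fib : V → Finset W} {T : V → V → A}
    (hT : ∀ v w, E.Adj v w → T v w = ∑ y ∈ fib w, s (σ v w) y) {v w : V} (hvw : E.Adj v w) :
    T v w * star (T v w) = ∑ y ∈ fib w, s (σ v w) y * star (s (σ v w) y) := by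
  rw [hT v w hvw, star_sum, Finset.sum_mul]
  refine Finset.sum_congr rfl fun x hx => ?_
  rw [Finset.mul_sum, Finset.sum_eq_single_of_mem x hx]
  exact fun y _ hy => hF.edge_mul_star_of_ne _ _ hy.symm

/-- The Cuntz-Krieger family of `E` obtained from one of a graph `F` that arises from `E` by
splitting vertices. -/
theorem collapse {p : W → A} {s : W → W → A} (hF : IsCKFamily F p s) (h : IsOutSplit E F φ σ)
    {N : V → Finset V} (hN : ∀ v w, w ∈ N v ↔ E.Adj v w)
    {M : W → Finset W} (hM : ∀ x y, y ∈ M x ↔ F.Adj x y)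
    {fib : V → Finset W} (hfib : ∀ v x, x ∈ fib v ↔ φ x = v) {T : V → V → A}
    (hT : ∀ v w, E.Adj v w → T v w = ∑ y ∈ fib w, s (σ v w) y)
    (hT0 : ∀ v w, ¬ E.Adj v w → T v w = 0) :
    IsCKFamily E (fun v => ∑ x ∈ fib v, p x) T where
  star_vertex v := by rw [star_sum]; exact Finset.sum_congr rfl fun x _ => hF.star_vertex x
  vertex_mul_self v := by
    simp only [Finset.sum_mul]
    refine Finset.sum_congr rfl fun x hx => ?_
    rw [Finset.mul_sum, Finset.sum_eq_single_of_mem x hx, hF.vertex_mul_self]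
    exact fun y _ hy => hF.vertex_mul x y hy.symm
  vertex_mul v w hvw := by
    simp only [Finset.sum_mul, Finset.mul_sum]
    refine Finset.sum_eq_zero fun y hy => Finset.sum_eq_zero fun x hx => hF.vertex_mul _ _ ?_
    rintro rfl
    exact hvw (((hfib _ _).1 ‹_›).symm.trans ((hfib _ _).1 ‹_›))
  star_mul_edge v w hvw := by
    rw [hT v w hvw, star_sum, Finset.sum_mul]
    refine Finset.sum_congr rfl fun x hx => ?_
    rw [Finset.mul_sum, Finset.sum_eq_single_of_mem x hx, hF.star_mul_edge]
    · exact h.adj_source ((hfib _ _).1 hx) hvw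
    · exact fun y _ hy => hF.star_mul_edge_of_ne _ (hM _) hy.symm
  eq_zero := hT0
  sum_edges v N' hN' hne := by
    classical
    obtain rfl : N' = N v := by
      ext w
      rw [hN', hN]
    have hTT (w : V) (hw : w ∈ N v) := hF.collapse_edge_mul_star hT ((hN v w).1 hw)
    -- Grouping the edges at v by the source of their copies leaves, for each x above v, the
    -- summation relation of F at x, valid because x is not a sink.
    rw [Finset.sum_congr rfl hTT, ← Finset.sum_fiberwise_of_maps_to (t := fib v) (g := σ v)
      fun w hw => (hfib _ _).2 (h.source _ _ ((hN _ _).1 hw))]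
    refine Finset.sum_congr rfl fun x hx => ?_
    obtain rfl := (hfib _ _).1 hx
    obtain ⟨w, hw⟩ := hne
    obtain ⟨y, hy⟩ := h.exists_adj_of_adj ((hN _ _).1 hw)
    rw [hF.sum_edges x (M x) (hM x) ⟨y, (hM _ _).2 hy⟩, h.sum_adj hN hfib (hM x)]
    refine Finset.sum_congr rfl fun w hw => ?_
    rw [(Finset.mem_filter.1 hw).2]

open Classical in
/-- The projections of the vertices of a graph that arises from `E` by splitting vertices, in terms
of a Cuntz-Krieger family of `E`. -/
def splitVertex (P : V → A) (S : V → V → A) (N : V → Finset V) (φ : W → V) (σ : V → V → W)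
    (x : W) : A :=
  if (N (φ x)).Nonempty then
    ∑ w ∈ (N (φ x)).filter (fun w => σ (φ x) w = x), S (φ x) w * star (S (φ x) w)
  -- Only one vertex lies above a sink, and it inherits the whole projection; the sum would be
  -- empty.
  else P (φ x)

variable {P : V → A} {S : V → V → A}

theorem edge_mul_star_mul_edge_mul_star (hE : IsCKFamily E P S) {N : V → Finset V}
    (hN : ∀ v w, w ∈ N v ↔ E.Adj v w) (v : V) {w x : V} (hwx : w ≠ x) :
    S v w * star (S v w) * (S v x * star (S v x)) = 0 := by
  rw [mul_assoc, ← mul_assoc (star _), hE.star_mul_edge_of_ne _ (hN v) hwx, zero_mul, mul_zero]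

theorem star_splitVertex (hE : IsCKFamily E P S) (N : V → Finset V) (x : W) :
    star (splitVertex P S N φ σ x) = splitVertex P S N φ σ x := by
  rw [splitVertex]
  split_ifs
  · simp
  · exact hE.star_vertex _

theorem splitVertex_mul_self (hE : IsCKFamily E P S) {N : V → Finset V}
    (hN : ∀ v w, w ∈ N v ↔ E.Adj v w) (x : W) :
    splitVertex P S N φ σ x * splitVertex P S N φ σ x = splitVertex P S N φ σ x := by
  rw [splitVertex]
  split_ifs
  · rw [Finset.sum_mul]
    refine Finset.sum_congr rfl fun w hw => ?_
    rw [Finset.mul_sum, Finset.sum_eq_single_of_mem w hw, ← mul_assoc, hE.edge_mul_star_mul_edge]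
    exact fun y _ hy => hE.edge_mul_star_mul_edge_mul_star hN _ hy.symm
  · exact hE.vertex_mul_self _

theorem vertex_mul_splitVertex (hE : IsCKFamily E P S) {N : V → Finset V}
    (hN : ∀ v w, w ∈ N v ↔ E.Adj v w) (x : W) :
    P (φ x) * splitVertex P S N φ σ x = splitVertex P S N φ σ x := by
  rw [splitVertex]
  split_ifs
  · rw [Finset.mul_sum]
    refine Finset.sum_congr rfl fun w _ => ?_
    rw [← mul_assoc, hE.vertex_mul_edge _ (hN _)]
  · exact hE.vertex_mul_self _

theorem splitVertex_mul_vertex (hE : IsCKFamily E P S) {N : V → Finset V}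
    (hN : ∀ v w, w ∈ N v ↔ E.Adj v w) (x : W) :
    splitVertex P S N φ σ x * P (φ x) = splitVertex P S N φ σ x := by
  simpa [hE.star_vertex, hE.star_splitVertex] using
    congrArg star (hE.vertex_mul_splitVertex (φ := φ) (σ := σ) hN x)

/-- In one fibre the two sums run over disjoint sets of edges with orthogonal range projections; in
different fibres the factors lie under orthogonal vertex projections. -/
theorem splitVertex_mul (hE : IsCKFamily E P S) (h : IsOutSplit E F φ σ) {N : V → Finset V}
    (hN : ∀ v w, w ∈ N v ↔ E.Adj v w) {x y : W} (hxy : x ≠ y) :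
    splitVertex P S N φ σ x * splitVertex P S N φ σ y = 0 := by
  by_cases hφ : φ x = φ y
  · classical
    obtain ⟨z, hz⟩ := h.exists_adj x y hφ hxy
    have hx : (N (φ x)).Nonempty := ⟨φ z, (hN _ _).2 ((h.adj_iff _ _).1 hz).1⟩
    rw [splitVertex, splitVertex, if_pos hx, if_pos (hφ ▸ hx), Finset.sum_mul]
    refine Finset.sum_eq_zero fun w hw => ?_
    rw [Finset.mul_sum]
    refine Finset.sum_eq_zero fun w' hw' => ?_
    rw [← hφ]
    refine hE.edge_mul_star_mul_edge_mul_star hN _ ?_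
    rintro rfl
    rw [Finset.mem_filter] at hw hw'
    rw [← hφ, hw.2] at hw'
    exact hxy hw'.2
  · rw [← hE.splitVertex_mul_vertex hN x, ← hE.vertex_mul_splitVertex hN y, mul_assoc,
      ← mul_assoc (P _), hE.vertex_mul _ _ hφ, zero_mul, mul_zero]

/-- The values of σ partition the edges at v among the vertices above v; over a sink the fibre is
one point. -/
theorem sum_splitVertex (hE : IsCKFamily E P S) (h : IsOutSplit E F φ σ) {N : V → Finset V}
    (hN : ∀ v w, w ∈ N v ↔ E.Adj v w) {fib : V → Finset W}
    (hfib : ∀ v x, x ∈ fib v ↔ φ x = v) (v : V) :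
    ∑ x ∈ fib v, splitVertex P S N φ σ x = P v := by
  classical
  by_cases hv : (N v).Nonempty
  · rw [hE.sum_edges v (N v) (hN v) hv,
      ← Finset.sum_fiberwise_of_maps_to (t := fib v) (g := σ v)
        fun w hw => (hfib _ _).2 (h.source _ _ ((hN _ _).1 hw))]
    refine Finset.sum_congr rfl fun x hx => ?_
    obtain rfl := (hfib _ _).1 hx
    rw [splitVertex, if_pos hv]
  · obtain ⟨x, rfl⟩ := h.surjective v
    rw [Finset.sum_eq_single_of_mem x ((hfib _ _).2 rfl), splitVertex, if_neg hv]
    intro y hy hyx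
    obtain ⟨z, hz⟩ := h.exists_adj y x ((hfib _ _).1 hy) hyx
    refine absurd ⟨φ z, ?_⟩ hv
    rw [hN, ← (hfib _ _).1 hy]
    exact ((h.adj_iff _ _).1 hz).1

theorem edge_eq_sum (hE : IsCKFamily E P S) (h : IsOutSplit E F φ σ) {N : V → Finset V}
    (hN : ∀ v w, w ∈ N v ↔ E.Adj v w) {fib : V → Finset W}
    (hfib : ∀ v x, x ∈ fib v ↔ φ x = v) (v w : V) :
    ∑ y ∈ fib w, S v w * splitVertex P S N φ σ y = S v w := by
  rw [← Finset.mul_sum, hE.sum_splitVertex h hN hfib, hE.edge_mul_vertex]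

/-- The Cuntz-Krieger family, obtained from one of `E`, of a graph `F` that arises from `E` by
splitting vertices. -/
theorem split (hE : IsCKFamily E P S) (h : IsOutSplit E F φ σ)
    {N : V → Finset V} (hN : ∀ v w, w ∈ N v ↔ E.Adj v w)
    {fib : V → Finset W} (hfib : ∀ v x, x ∈ fib v ↔ φ x = v) {t : W → W → A}
    (ht : ∀ x y, F.Adj x y → t x y = S (φ x) (φ y) * splitVertex P S N φ σ y)
    (ht0 : ∀ x y, ¬ F.Adj x y → t x y = 0) :
    IsCKFamily F (splitVertex P S N φ σ) t where
  star_vertex := hE.star_splitVertex N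
  vertex_mul_self := hE.splitVertex_mul_self hN
  vertex_mul _ _ := hE.splitVertex_mul h hN
  star_mul_edge x y hxy := by
    rw [ht x y hxy, star_mul, hE.star_splitVertex, mul_assoc, ← mul_assoc (star _),
      hE.star_mul_edge _ _ ((h.adj_iff _ _).1 hxy).1, hE.vertex_mul_splitVertex hN,
      hE.splitVertex_mul_self hN]
  eq_zero := ht0
  sum_edges x M hM hne := by
    classical
    obtain ⟨z, hz⟩ := hne
    have hx : (N (φ x)).Nonempty := ⟨φ z, (hN _ _).2 ((h.adj_iff _ _).1 ((hM _).1 hz)).1⟩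
    rw [h.sum_adj hN hfib hM, splitVertex, if_pos hx]
    refine Finset.sum_congr (by ext; simp) fun w hw => ?_
    rw [Finset.mem_filter, hN] at hw
    -- With t = SQ_y each term is S Q_y S^*, and the Q_y above w add up to P_w, which S absorbs.
    have hty (y : W) (hy : y ∈ fib w) : t x y * star (t x y) =
        S (φ x) w * splitVertex P S N φ σ y * star (S (φ x) w) := by
      obtain rfl := (hfib _ _).1 hy
      rw [ht x y ((h.adj_iff _ _).2 hw), star_mul, hE.star_splitVertex, mul_assoc,
        ← mul_assoc (splitVertex P S N φ σ y), hE.splitVertex_mul_self hN, ← mul_assoc]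
    rw [Finset.sum_congr rfl hty, ← Finset.sum_mul, hE.edge_eq_sum h hN hfib]

/-- Collapsing and then splitting recovers the vertex projections: the relation of F at x, grouped
by edges of E, is the sum of T T^* that defines Q_x. -/
theorem splitVertex_collapse {p : W → A} {s : W → W → A} (hF : IsCKFamily F p s)
    (h : IsOutSplit E F φ σ) {N : V → Finset V} (hN : ∀ v w, w ∈ N v ↔ E.Adj v w)
    {M : W → Finset W} (hM : ∀ x y, y ∈ M x ↔ F.Adj x y)
    {fib : V → Finset W} (hfib : ∀ v x, x ∈ fib v ↔ φ x = v) {T : V → V → A}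
    (hT : ∀ v w, E.Adj v w → T v w = ∑ y ∈ fib w, s (σ v w) y) (x : W) :
    splitVertex (fun v => ∑ x ∈ fib v, p x) T N φ σ x = p x := by
  classical
  rw [splitVertex]
  split_ifs with hx
  · obtain ⟨w, hw⟩ := hx
    obtain ⟨y, hy⟩ := h.exists_adj_of_adj ((hN _ _).1 hw)
    rw [hF.sum_edges x (M x) (hM x) ⟨y, (hM _ _).2 hy⟩, h.sum_adj hN hfib (hM x)]
    refine Finset.sum_congr (by ext; simp) fun w hw => ?_
    rw [Finset.mem_filter, hN] at hw
    rw [hF.collapse_edge_mul_star hT hw.1, hw.2]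
  · refine Finset.sum_eq_single_of_mem x ((hfib _ _).2 rfl) fun y hy hyx => ?_
    obtain ⟨z, hz⟩ := h.exists_adj y x ((hfib _ _).1 hy) hyx
    refine absurd ⟨φ z, ?_⟩ hx
    rw [hN, ← (hfib _ _).1 hy]
    exact ((h.adj_iff _ _).1 hz).1

theorem map_splitVertex {B : Type*} [NonUnitalCStarAlgebra B] (f : A →⋆ₙₐ[ℂ] B)
    (N : V → Finset V) (x : W) :
    f (splitVertex P S N φ σ x) =
      splitVertex (fun v => f (P v)) (fun v w => f (S v w)) N φ σ x := by
  rw [splitVertex, splitVertex]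
  split_ifs
  · simp only [map_sum, map_mul, map_star]
  · rfl

end IsCKFamily

/-! ### The isomorphism induced by an out-splitting. -/

/-- Splitting vertices of a row-finite graph does not change its C*-algebra. -/
theorem IsOutSplit.nonempty_starAlgEquiv {φ : W → V} {σ : V → V → W} (h : IsOutSplit E F φ σ)
    (hE : E.RowFinite) : Nonempty (E.GraphCStarAlgebra ≃⋆ₐ[ℂ] F.GraphCStarAlgebra) := by
  classical
  have hF := Digraph.rowFinite_iff.1 (h.rowFinite_iff.2 hE)
  rw [Digraph.rowFinite_iff] at hE
  let N (v : V) : Finset V := (hE v).toFinset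
  have hN (v w : V) : w ∈ N v ↔ E.Adj v w := (hE v).mem_toFinset
  let M (x : W) : Finset W := (hF x).toFinset
  have hM (x y : W) : y ∈ M x ↔ F.Adj x y := (hF x).mem_toFinset
  let fib (v : V) : Finset W := (h.finite_fiber v).toFinset
  have hfib (v : V) (x : W) : x ∈ fib v ↔ φ x = v := (h.finite_fiber v).mem_toFinset
  have cE := isCKFamily_canonical E
  have cF := isCKFamily_canonical F
  let T (v w : V) : F.GraphCStarAlgebra :=
    if E.Adj v w then ∑ y ∈ fib w, F.canonicalPair (σ v w) y else 0
  have hT (v w : V) (hvw : E.Adj v w) : T v w = ∑ y ∈ fib w, F.canonicalPair (σ v w) y :=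
    if_pos hvw
  have hT0 (v w : V) (hvw : ¬ E.Adj v w) : T v w = 0 := if_neg hvw
  let Q := IsCKFamily.splitVertex E.canonicalVertex E.canonicalPair N φ σ
  let t (x y : W) : E.GraphCStarAlgebra :=
    if F.Adj x y then E.canonicalPair (φ x) (φ y) * Q y else 0
  have ht (x y : W) (hxy : F.Adj x y) : t x y = E.canonicalPair (φ x) (φ y) * Q y := if_pos hxy
  have ht0 (x y : W) (hxy : ¬ F.Adj x y) : t x y = 0 := if_neg hxy
  obtain ⟨f, hfP, hfS⟩ := (cF.collapse h hN hM hfib hT hT0).exists_hom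
  obtain ⟨g, hgP, hgS⟩ := (cE.split h hN hfib ht ht0).exists_hom
  have hfS' (v w : V) : f (E.canonicalPair v w) = T v w := by
    by_cases hvw : E.Adj v w
    · rw [canonicalPair, dif_pos hvw]
      exact hfS _
    · rw [canonicalPair, dif_neg hvw, map_zero, hT0 v w hvw]
  have hgS' (x y : W) : g (F.canonicalPair x y) = t x y := by
    by_cases hxy : F.Adj x y
    · rw [canonicalPair, dif_pos hxy]
      exact hgS _
    · rw [canonicalPair, dif_neg hxy, map_zero, ht0 x y hxy]
  -- Right multiplication by p_y keeps only the summand of T with range y.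
  have hTp (x y : W) (hxy : F.Adj x y) :
      T (φ x) (φ y) * F.canonicalVertex y = F.canonicalPair x y := by
    obtain ⟨h1, h2⟩ := (h.adj_iff _ _).1 hxy
    rw [hT _ _ h1, h2, Finset.sum_mul, Finset.sum_eq_single_of_mem y ((hfib _ _).2 rfl),
      cF.edge_mul_vertex]
    intro z _ hz
    rw [← cF.edge_mul_vertex, mul_assoc, cF.vertex_mul _ _ hz, mul_zero]
  have hfQ (x : W) : f (Q x) = F.canonicalVertex x := by
    rw [IsCKFamily.map_splitVertex]
    simp only [hfP, hfS']
    exact cF.splitVertex_collapse h hN hM hfib hT x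
  refine ⟨StarAlgEquiv.ofNonUnitalStarAlgHom f g ?_ ?_⟩
  · refine GraphCStarAlgebra.hom_ext (fun v => ?_) fun e => ?_
    · change g (f _) = E.canonicalVertex v
      rw [hfP, map_sum]
      simp only [hgP]
      exact cE.sum_splitVertex h hN hfib v
    · change g (f _) = E.canonicalEdge e
      rw [hfS, ← canonicalPair_source_range, hT _ _ e.adj, map_sum]
      simp only [hgS']
      refine (Finset.sum_congr rfl fun y hy => ?_).trans
        (cE.edge_eq_sum h hN hfib e.source e.range)
      rw [ht _ _ (h.adj_source ((hfib _ _).1 hy) e.adj), (hfib _ _).1 hy, h.source _ _ e.adj]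
  · refine GraphCStarAlgebra.hom_ext (fun x => ?_) fun e => ?_
    · change f (g _) = F.canonicalVertex x
      rw [hgP]
      exact hfQ x
    · change f (g _) = F.canonicalEdge e
      rw [hgS, ht _ _ e.adj, map_mul, hfS', hfQ, hTp _ _ e.adj, canonicalPair_source_range]

end Digraph

end

/-! ### Isomorphisms and edge explosions as out-splittings. -/

noncomputable section

namespace Digraph

variable {V W : Type u} {E : Digraph V} {F : Digraph W}

theorem isOutSplit_of_relIso (g : E.Adj ≃r F.Adj) :
    IsOutSplit E F g.symm fun v _ => g v where
  surjective := g.symm.surjective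
  finite_fiber v := (Set.finite_singleton v).preimage g.symm.injective.injOn
  source v _ _ := g.symm_apply_apply v
  adj_iff x y := by
    rw [g.symm.map_rel_iff]
    simp
  exists_adj _ _ hxy hne := absurd (g.symm.injective hxy) hne

open Classical in
theorem isOutSplit_edgeExplosion (e : E.Edge) (he : (E.edgesFrom e.source).Nontrivial) :
    IsOutSplit E (E.edgeExplosion e) SplitVertex.forget fun v w =>
      if h : v = e.source then if w = e.range then .fst else .snd else .old v h where
  surjective v := by
    by_cases h : v = e.source
    · exact ⟨.fst, h.symm⟩
    · exact ⟨.old v h, rfl⟩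
  finite_fiber v := by
    by_cases h : v = e.source
    · refine (Set.toFinite {.fst, .snd}).subset ?_
      rintro (⟨u, hu⟩ | _ | _) hx
      · exact absurd (Eq.trans hx h) hu
      · exact Or.inl rfl
      · exact Or.inr rfl
    · refine (Set.finite_singleton (.old v h)).subset ?_
      rintro (⟨u, hu⟩ | _ | _) hx
      · obtain rfl : u = v := hx
        rfl
      · exact absurd (Eq.symm hx) h
      · exact absurd (Eq.symm hx) h
  source v w _ := by
    split_ifs with h1 h2
    · exact h1.symm
    · exact h1.symm
    · rfl
  adj_iff x y := by
    rcases x with ⟨u, hu⟩ | _ | _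
    · simp [edgeExplosion, SplitVertex.forget, hu]
    · have h (hy : y.forget = e.range) : E.Adj e.source y.forget := hy ▸ e.adj
      by_cases hy : y.forget = e.range <;> simp_all [edgeExplosion, SplitVertex.forget]
    · by_cases hy : y.forget = e.range <;> simp_all [edgeExplosion, SplitVertex.forget]
  exists_adj x y hxy hne := by
    have lift (w : V) : ∃ z : SplitVertex e.source, z.forget = w := by
      by_cases h : w = e.source
      · exact ⟨.fst, h.symm⟩
      · exact ⟨.old w h, rfl⟩
    rcases x with ⟨u, hu⟩ | _ | _
    · rcases y with ⟨u', hu'⟩ | _ | _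
      · obtain rfl : u = u' := hxy
        exact absurd rfl hne
      · exact absurd hxy hu
      · exact absurd hxy hu
    · exact lift e.range
    -- The only use of the assumption that the source of e emits a second edge: a copy of that edge
    -- leaves v'', so v'' is not a sink.
    · obtain ⟨f, hf, hfe⟩ := he.exists_ne e
      obtain ⟨z, hz⟩ := lift f.range
      have hf : f.source = e.source := hf
      refine ⟨z, hz ▸ hf ▸ f.adj, fun h => hfe ?_⟩
      exact Subtype.ext (Prod.ext hf (hz.symm.trans h))

theorem IsEdgeExplosion.rowFinite_iff (h : IsEdgeExplosion E F) : F.RowFinite ↔ E.RowFinite := by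
  obtain ⟨e, he, ⟨g⟩⟩ := h
  rw [(isOutSplit_of_relIso g.symm).rowFinite_iff, (isOutSplit_edgeExplosion e he).rowFinite_iff]

theorem IsEdgeExplosion.nonempty_starAlgEquiv (h : IsEdgeExplosion E F) (hE : E.RowFinite) :
    Nonempty (E.GraphCStarAlgebra ≃⋆ₐ[ℂ] F.GraphCStarAlgebra) := by
  obtain ⟨e, he, ⟨g⟩⟩ := h
  have hs := isOutSplit_edgeExplosion e he
  obtain ⟨a⟩ := hs.nonempty_starAlgEquiv hE
  obtain ⟨b⟩ := (isOutSplit_of_relIso g.symm).nonempty_starAlgEquiv (hs.rowFinite_iff.2 hE)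
  exact ⟨a.trans b⟩

end Digraph

end

theorem mainTheorem5 {V W : Type u} (E : Digraph V) (F : Digraph W) (hE : E.RowFinite)
    (h : E.ExplosionEquivalent F) :
    F.RowFinite ∧ Nonempty (E.GraphCStarAlgebra ≃⋆ₐ[ℂ] F.GraphCStarAlgebra) := by
  obtain ⟨n, X, G, ⟨g⟩, ⟨g'⟩, hG⟩ := h
  have key (i : Fin (n + 1)) :
      (G i).RowFinite ∧ Nonempty (E.GraphCStarAlgebra ≃⋆ₐ[ℂ] (G i).GraphCStarAlgebra) := by
    induction i using Fin.induction with
    | zero =>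
      have hs := Digraph.isOutSplit_of_relIso g
      exact ⟨hs.rowFinite_iff.2 hE, hs.nonempty_starAlgEquiv hE⟩
    | succ i ih =>
      obtain ⟨hi, ⟨a⟩⟩ := ih
      rcases hG i with h | h
      · obtain ⟨b⟩ := h.nonempty_starAlgEquiv hi
        exact ⟨h.rowFinite_iff.2 hi, ⟨a.trans b⟩⟩
      -- For a backward step the isomorphism is built from the unexploded graph, so row-finiteness
      -- has to be passed down to it beforehand.
      · have hi' := h.rowFinite_iff.1 hi
        obtain ⟨b⟩ := h.nonempty_starAlgEquiv hi'
        exact ⟨hi', ⟨a.trans b.symm⟩⟩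
  obtain ⟨hn, ⟨a⟩⟩ := key (Fin.last n)
  have hs := Digraph.isOutSplit_of_relIso g'
  obtain ⟨b⟩ := hs.nonempty_starAlgEquiv hn
  exact ⟨hs.rowFinite_iff.2 hn, ⟨a.trans b⟩⟩
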